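/- Let $N\ge 1$ and let $\mathcal H_A=\mathcal H_B=\mathbb C^N$. Let $\mathcal E_A,\mathcal E_B$ be quantum channels on the two systems, given by finitely many Kraus operators, $\mathcal E(\rho)=\sum_k E_k\rho E_k^\dagger$ with $\sum_k E_k^\dagger E_k=I$, and let $\mathcal E^\dagger(M)=\sum_k E_k^\dagger M E_k$ denote the adjoint map. Let $\mathcal M_a$ and $\mathcal M_b$ be elements of finite POVMs on $\mathcal H_A$ and $\mathcal H_B$ (for instance rank-one projectors $|\phi_a\rangle\langle\phi_a|$, $|\phi_b\rangle\langle\phi_b|$), and put $$\mathcal K_a=\mathcal E_A^\dagger(\mathcal M_a),\qquad \mathcal K_b=\mathcal E_B^\dagger(\mathcal M_b),\qquad \mathcal K_\phi=\mathcal K_a\otimes\mathcal K_b .$$ Let $\alpha_1\ge\dots\ge\alpha_N$ and $\beta_1\ge\dots\ge\beta_N$ be the eigenvalues, with multiplicity, of $\mathcal K_a$ and $\mathcal K_b$. For $s\in\mathbb R$ let $\mathbb H_s$ be the set of unit vectors $\psi\in\mathcal H_A\otimes\mathcal H_B$ whose entanglement entropy (the von Neumann entropy, with natural logarithm, of $\operatorname{Tr}_B|\psi\rangle\langle\psi|$)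 is at least $s$, and define $$J_{\min}(\mathcal K_\phi,s)=\min_{\psi\in\mathbb H_s}\langle\psi|\mathcal K_\phi|\psi\rangle,\qquad \sigma_{\min}(\mathcal K_\phi)=J_{\min}(\mathcal K_\phi,0),$$ so that $\sigma_{\min}(\mathcal K_\phi)$ is the minimum over all unit vectors. Put $\widetilde\mu_i=\alpha_i\beta_N$, $d_{\min}=\#\{j:\widetilde\mu_j=\widetilde\mu_N\}$, and $$\widetilde J_{\min}(\mathcal K_\phi,s)=\min\Big\{\sum_{j=1}^N\widetilde\mu_j\lambda_j:\ \lambda_j\ge 0,\ \sum_{j=1}^N\lambda_j=1,\ -\sum_{j=1}^N\lambda_j\log\lambda_j\ge s\Big\}.$$ Theorem. Let $s\le\log N$. Both minima $J_{\min}(\mathcal K_\phi,s)$ and $\widetilde J_{\min}(\mathcal K_\phi,s)$ are attained, $\widetilde\mu_N=\sigma_{\min}(\mathcal K_\phi)$, and $$J_{\min}(\mathcal K_\phi,s)\ \ge\ \widetilde J_{\min}(\mathcal K_\phi,s).$$ Moreover: (i) If $s\le\log d_{\min}$, then $\widetilde J_{\min}(\mathcal K_\phi,s)=\widetilde\mu_N=\sigma_{\min}(\mathcal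 K_\phi)$. (ii) If $\log d_{\min}<s\le\log N$, then, with $\widetilde Z(\gamma)=\sum_{j=1}^N e^{-\gamma\widetilde\mu_j}$, there is exactly one $\widetilde\gamma\ge 0$ satisfying the entropy equation $$\log\widetilde Z(\widetilde\gamma)+\frac{\widetilde\gamma}{\widetilde Z(\widetilde\gamma)}\sum_{j=1}^N\widetilde\mu_j e^{-\widetilde\gamma\widetilde\mu_j}=s .$$ It satisfies $\widetilde\gamma>0$ if $s<\log N$, and $$\widetilde J_{\min}(\mathcal K_\phi,s)=\frac1{\widetilde Z(\widetilde\gamma)}\sum_{j=1}^N\widetilde\mu_j e^{-\widetilde\gamma\widetilde\mu_j}>\sigma_{\min}(\mathcal K_\phi).$$ (iii) If $s=\log N$, then $$J_{\min}(\mathcal K_\phi,\log N)=\frac1N\sum_{i=1}^N\alpha_i\beta_{N-i+1},\qquad \widetilde J_{\min}(\mathcal K_\phi,\log N)=\frac1N\sum_{i=1}^N\widetilde\mu_i,$$ and $J_{\min}(\mathcal K_\phi,t)\le J_{\min}(\mathcal K_\phi,\log N)$ for every $t\le\log N$. -/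

import Mathlib

open scoped Matrix Kronecker ComplexOrder

noncomputable section

namespace QPrivacy

/-- A quantum channel on an `N`-dimensional system, given by finitely many Kraus operators `E k` with
`∑ k, (E k)ᴴ * E k = 1`. -/
structure Channel (N : ℕ) where
  size : ℕ
  kraus : Fin size → Matrix (Fin N) (Fin N) ℂ
  sum_eq_one : ∑ k, (kraus k)ᴴ * kraus k = 1

/-- The action of the channel on operators, `ρ ↦ ∑ k, E k * ρ * (E k)ᴴ`. -/
def Channel.apply {N : ℕ} (E : Channel N) (ρ : Matrix (Fin N) (Fin N) ℂ) :
    Matrix (Fin N) (Fin N) ℂ :=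
  ∑ k, E.kraus k * ρ * (E.kraus k)ᴴ

/-- The adjoint (Heisenberg picture) map, `M ↦ ∑ k, (E k)ᴴ * M * E k`. -/
def Channel.adjoint {N : ℕ} (E : Channel N) (M : Matrix (Fin N) (Fin N) ℂ) :
    Matrix (Fin N) (Fin N) ℂ :=
  ∑ k, (E.kraus k)ᴴ * M * E.kraus k

theorem Channel.trace_mul_apply {N : ℕ} (E : Channel N) (M ρ : Matrix (Fin N) (Fin N) ℂ) :
    (M * E.apply ρ).trace = (E.adjoint M * ρ).trace := by
  simp only [Channel.apply, Channel.adjoint, Finset.mul_sum, Finset.sum_mul, Matrix.trace_sum]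
  refine Finset.sum_congr rfl fun k _ => ?_
  rw [← Matrix.mul_assoc, Matrix.trace_mul_comm]
  simp only [Matrix.mul_assoc]

/-- A positive operator-valued measurement with finite outcome set `O`. -/
structure POVM (N : ℕ) (O : Type*) [Fintype O] where
  elem : O → Matrix (Fin N) (Fin N) ℂ
  posSemidef : ∀ k, (elem k).PosSemidef
  sum_eq_one : ∑ k, elem k = 1

/-- The local observable `E†(M_a)` induced by the channel `E` and the outcome `a`. -/
def localObservable {N : ℕ} {O : Type*} [Fintype O] (E : Channel N) (M : POVM N O) (a : O) :
    Matrix (Fin N) (Fin N) ℂ :=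
  E.adjoint (M.elem a)

theorem localObservable_isHermitian {N : ℕ} {O : Type*} [Fintype O] (E : Channel N)
    (M : POVM N O) (a : O) : (localObservable E M a).IsHermitian := by
  unfold localObservable Channel.adjoint
  rw [Matrix.IsHermitian, Matrix.conjTranspose_sum]
  refine Finset.sum_congr rfl fun k _ => ?_
  simp [Matrix.conjTranspose_mul, (M.posSemidef a).isHermitian.eq, Matrix.mul_assoc]

/-- The eigenvalues of a Hermitian matrix, listed with multiplicity in nonincreasing order. -/
def sortedEigenvalues {N : ℕ} {K : Matrix (Fin N) (Fin N) ℂ} (hK : K.IsHermitian) (i : Fin N) : ℝ :=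
  hK.eigenvalues₀ (Fin.cast (Fintype.card_fin N).symm i)

/-- The operator `|ψ⟩⟨ψ|`. -/
def pureDensity {N : ℕ} (ψ : EuclideanSpace ℂ (Fin N × Fin N)) :
    Matrix (Fin N × Fin N) (Fin N × Fin N) ℂ :=
  Matrix.of fun x y => ψ x * star (ψ y)

/-- The partial trace over the second tensor factor. -/
def partialTraceB {N : ℕ} (ρ : Matrix (Fin N × Fin N) (Fin N × Fin N) ℂ) :
    Matrix (Fin N) (Fin N) ℂ :=
  Matrix.of fun i j => ∑ k, ρ (i, k) (j, k)

theorem reducedState_isHermitian {N : ℕ} (ψ : EuclideanSpace ℂ (Fin N × Fin N)) :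
    (partialTraceB (pureDensity ψ)).IsHermitian := by
  ext i j
  simp [partialTraceB, pureDensity, Matrix.conjTranspose_apply, mul_comm]

/-- The von Neumann entropy `-∑ λ_j log λ_j` of a Hermitian matrix with eigenvalues `λ_j`. -/
def vonNeumannEntropy {N : ℕ} {ρ : Matrix (Fin N) (Fin N) ℂ} (hρ : ρ.IsHermitian) : ℝ :=
  ∑ i, Real.negMulLog (hρ.eigenvalues i)

/-- The entanglement entropy of a bipartite pure state. -/
def entanglementEntropy {N : ℕ} (ψ : EuclideanSpace ℂ (Fin N × Fin N)) : ℝ :=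
  vonNeumannEntropy (reducedState_isHermitian ψ)

/-- Pure states (unit vectors of `ℂ^N ⊗ ℂ^N`) with entanglement entropy at least `s`. -/
def entangledStates (N : ℕ) (s : ℝ) : Set (EuclideanSpace ℂ (Fin N × Fin N)) :=
  {ψ | ‖ψ‖ = 1 ∧ s ≤ entanglementEntropy ψ}

/-- The energy `⟨ψ|K|ψ⟩` (which is a real number when `K` is Hermitian). -/
def energy {N : ℕ} (K : Matrix (Fin N × Fin N) (Fin N × Fin N) ℂ)
    (ψ : EuclideanSpace ℂ (Fin N × Fin N)) : ℝ :=
  (star ψ.ofLp ⬝ᵥ (K *ᵥ ψ.ofLp)).re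

/-- The minimal privacy energy over the states with entanglement entropy at least `s`. -/
def Jmin {N : ℕ} (K : Matrix (Fin N × Fin N) (Fin N × Fin N) ℂ) (s : ℝ) : ℝ :=
  sInf (energy K '' entangledStates N s)

/-- The minimal energy over all pure states, i.e. without an entanglement constraint. -/
def sigmaMin {N : ℕ} (K : Matrix (Fin N × Fin N) (Fin N × Fin N) ℂ) : ℝ :=
  Jmin K 0

/-- Probability vectors with Shannon entropy at least `s`. -/
def entropicSimplex (N : ℕ) (s : ℝ) : Set (Fin N → ℝ) :=
  {p | p ∈ stdSimplex ℝ (Fin N) ∧ s ≤ ∑ j, Real.negMulLog (p j)}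

/-- The relaxed minimal energy with levels `μ`: the minimum of `∑ j, μ j * p j` over probability
vectors `p` with Shannon entropy at least `s`. -/
def relaxedJmin {N : ℕ} (μ : Fin N → ℝ) (s : ℝ) : ℝ :=
  sInf ((fun p : Fin N → ℝ => ∑ j, μ j * p j) '' entropicSimplex N s)

/-- The partition function `Z(γ) = ∑ j, exp (-γ μ_j)`. -/
def partitionFn {N : ℕ} (μ : Fin N → ℝ) (γ : ℝ) : ℝ :=
  ∑ j, Real.exp (-γ * μ j)

/-- The Gibbs average `Z(γ)⁻¹ ∑ j, μ_j exp (-γ μ_j)`. -/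
def gibbsAverage {N : ℕ} (μ : Fin N → ℝ) (γ : ℝ) : ℝ :=
  (partitionFn μ γ)⁻¹ * ∑ j, μ j * Real.exp (-γ * μ j)

end QPrivacy

end

open scoped Matrix Kronecker ComplexOrder

namespace QPrivacy

/-! ### Shannon entropy and the Gibbs variational principle -/

/-! In eigenbases `U`, `V` of the two local observables the energy of `ψ` is `∑ α i * β j * ‖C i j‖
^ 2`, with `C` the coefficient matrix of `ψ` in the product basis (`energy_kronecker_diagonal`).
Since `α ≥ 0`, lowering every `β j` to the smallest one leaves `∑ μ i * p i`, where `p` is the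
diagonal of the reduced state in the basis `U`. Passing to a diagonal cannot decrease entropy
(`entanglementEntropy_le_sum_populations`), so `p` is feasible for the relaxed problem; this gives
the lower bound.

The relaxed problem is governed by Gibbs' inequality: for every `γ`, the entropy of `p` is at most
`log Z(γ) + γ * ∑ μ j * p j`, strictly unless `p` is the Gibbs distribution. For `γ > 0` this makes
the Gibbs state optimal at its own entropy, and its strict form makes `γ` unique. Existence is the
intermediate value theorem: the Gibbs entropy is `log N` at `γ = 0` and tends to `log dmin` as `γ →
∞`.

At `s = log N` the reduced state is `1 / N`, so the matrix `N * ‖C i j‖ ^ 2` is doubly stochastic;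
Birkhoff's theorem and the rearrangement inequality give the minimum, attained by pairing the
eigenbases in opposite orders. -/

theorem negMulLog_add_mul_log_lt {p q : ℝ} (hp : 0 ≤ p) (hq : 0 < q) (hpq : p ≠ q) :
    Real.negMulLog p + p * Real.log q < q - p := by
  rcases hp.eq_or_lt with rfl | hp
  · simpa using hq
  · have h := Real.log_lt_sub_one_of_pos (div_pos hq hp) (by
      rw [ne_eq, div_eq_one_iff_eq hp.ne']; exact fun h => hpq h.symm)
    rw [Real.log_div hq.ne' hp.ne'] at h
    have h2 := mul_lt_mul_of_pos_left h hp
    have h3 : p * (q / p - 1) = q - p := by field_simp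
    rw [h3] at h2
    rw [Real.negMulLog]
    linarith

theorem negMulLog_add_mul_log_self (q : ℝ) : Real.negMulLog q + q * Real.log q = 0 := by
  rw [Real.negMulLog]; ring

theorem negMulLog_add_mul_log_le {p q : ℝ} (hp : 0 ≤ p) (hq : 0 < q) :
    Real.negMulLog p + p * Real.log q ≤ q - p := by
  by_cases h : p = q
  · subst h; simp [negMulLog_add_mul_log_self]
  · exact (negMulLog_add_mul_log_lt hp hq h).le

variable {ι : Type*} [Fintype ι]

/-- Nonnegativity of relative entropy, by summing the pointwise bound: the terms `q j - p j` cancel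
in total. Only `q` must be positive; `p` may vanish somewhere. -/
theorem sum_negMulLog_le_neg_sum_mul_log {p q : ι → ℝ} (hp : p ∈ stdSimplex ℝ ι)
    (hq : ∀ j, 0 < q j) (hq1 : ∑ j, q j = 1) :
    ∑ j, Real.negMulLog (p j) ≤ -∑ j, p j * Real.log (q j) := by
  have h := Finset.sum_le_sum fun j (_ : j ∈ Finset.univ) =>
    negMulLog_add_mul_log_le (hp.1 j) (hq j)
  rw [Finset.sum_add_distrib, Finset.sum_sub_distrib, hp.2, hq1] at h
  linarith

theorem sum_negMulLog_lt_neg_sum_mul_log {p q : ι → ℝ} (hp : p ∈ stdSimplex ℝ ι)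
    (hq : ∀ j, 0 < q j) (hq1 : ∑ j, q j = 1) (hpq : p ≠ q) :
    ∑ j, Real.negMulLog (p j) < -∑ j, p j * Real.log (q j) := by
  obtain ⟨i, hi⟩ := Function.ne_iff.mp hpq
  have h := Finset.sum_lt_sum
    (fun j (_ : j ∈ Finset.univ) => negMulLog_add_mul_log_le (hp.1 j) (hq j))
    ⟨i, Finset.mem_univ i, negMulLog_add_mul_log_lt (hp.1 i) (hq i) hi⟩
  rw [Finset.sum_add_distrib, Finset.sum_sub_distrib, hp.2, hq1] at h
  linarith

theorem sum_negMulLog_nonneg {p : ι → ℝ} (hp : p ∈ stdSimplex ℝ ι) :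
    0 ≤ ∑ j, Real.negMulLog (p j) := by
  refine Finset.sum_nonneg fun j _ => Real.negMulLog_nonneg (hp.1 j) ?_
  rw [← hp.2]
  exact Finset.single_le_sum (fun i _ => hp.1 i) (Finset.mem_univ j)

variable {N : ℕ}

theorem continuous_sum_negMulLog :
    Continuous fun p : ι → ℝ => ∑ j, Real.negMulLog (p j) :=
  continuous_finsetSum _ fun j _ => Real.continuous_negMulLog.comp (continuous_apply j)

/-- The Gibbs distribution with levels `μ` at inverse temperature `γ`. -/
noncomputable def gibbs (μ : Fin N → ℝ) (γ : ℝ) (j : Fin N) : ℝ :=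
  Real.exp (-γ * μ j) / partitionFn μ γ

section Gibbs

variable (μ : Fin N → ℝ) (γ : ℝ)

theorem partitionFn_pos [NeZero N] : 0 < partitionFn μ γ :=
  Finset.sum_pos (fun _ _ => Real.exp_pos _) Finset.univ_nonempty

theorem gibbs_pos [NeZero N] (j : Fin N) : 0 < gibbs μ γ j :=
  div_pos (Real.exp_pos _) (partitionFn_pos μ γ)

theorem sum_gibbs [NeZero N] : ∑ j, gibbs μ γ j = 1 := by
  simp only [gibbs, ← Finset.sum_div]
  exact div_self (partitionFn_pos μ γ).ne'

theorem gibbs_mem_stdSimplex [NeZero N] : gibbs μ γ ∈ stdSimplex ℝ (Fin N) :=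
  ⟨fun j => (gibbs_pos μ γ j).le, sum_gibbs μ γ⟩

theorem log_gibbs [NeZero N] (j : Fin N) :
    Real.log (gibbs μ γ j) = -γ * μ j - Real.log (partitionFn μ γ) := by
  rw [gibbs, Real.log_div (Real.exp_pos _).ne' (partitionFn_pos μ γ).ne', Real.log_exp]

theorem gibbsAverage_eq_sum : gibbsAverage μ γ = ∑ j, μ j * gibbs μ γ j := by
  rw [gibbsAverage, Finset.mul_sum]
  refine Finset.sum_congr rfl fun j _ => ?_
  rw [gibbs]; ring

/-- The logarithm of a Gibbs weight is affine in the level, so the cross-entropy depends on `p` only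
through its mean energy. This turns Gibbs' inequality into the variational principle. -/
theorem neg_sum_mul_log_gibbs [NeZero N] {p : Fin N → ℝ} (hp : p ∈ stdSimplex ℝ (Fin N)) :
    -∑ j, p j * Real.log (gibbs μ γ j) =
      Real.log (partitionFn μ γ) + γ * ∑ j, μ j * p j := by
  have h : ∀ j, p j * Real.log (gibbs μ γ j) =
      -(γ * (μ j * p j)) - p j * Real.log (partitionFn μ γ) := fun j => by
    rw [log_gibbs]; ring
  simp only [h, Finset.sum_sub_distrib, ← Finset.sum_mul, hp.2, Finset.sum_neg_distrib,
    ← Finset.mul_sum]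
  ring

theorem sum_negMulLog_gibbs [NeZero N] :
    ∑ j, Real.negMulLog (gibbs μ γ j) =
      Real.log (partitionFn μ γ) + γ * gibbsAverage μ γ := by
  rw [gibbsAverage_eq_sum, ← neg_sum_mul_log_gibbs μ γ (gibbs_mem_stdSimplex μ γ),
    ← Finset.sum_neg_distrib]
  exact Finset.sum_congr rfl fun j _ => by rw [Real.negMulLog]; ring

theorem sum_negMulLog_le_log_partitionFn_add [NeZero N] {p : Fin N → ℝ}
    (hp : p ∈ stdSimplex ℝ (Fin N)) :
    ∑ j, Real.negMulLog (p j) ≤ Real.log (partitionFn μ γ) + γ * ∑ j, μ j * p j := by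
  rw [← neg_sum_mul_log_gibbs μ γ hp]
  exact sum_negMulLog_le_neg_sum_mul_log hp (gibbs_pos μ γ) (sum_gibbs μ γ)

theorem sum_negMulLog_lt_log_partitionFn_add [NeZero N] {p : Fin N → ℝ}
    (hp : p ∈ stdSimplex ℝ (Fin N))
    (hne : p ≠ gibbs μ γ) :
    ∑ j, Real.negMulLog (p j) < Real.log (partitionFn μ γ) + γ * ∑ j, μ j * p j := by
  rw [← neg_sum_mul_log_gibbs μ γ hp]
  exact sum_negMulLog_lt_neg_sum_mul_log hp (gibbs_pos μ γ) (sum_gibbs μ γ) hne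

@[simp] theorem partitionFn_zero : partitionFn μ 0 = N := by simp [partitionFn]

theorem gibbs_zero : gibbs μ 0 = fun _ => (N : ℝ)⁻¹ := by
  ext j; simp [gibbs]

variable (N) in
theorem uniform_mem_stdSimplex [NeZero N] : (fun _ => (N : ℝ)⁻¹) ∈ stdSimplex ℝ (Fin N) := by
  rw [← gibbs_zero 0]; exact gibbs_mem_stdSimplex 0 0

variable (N) in
theorem sum_negMulLog_uniform [NeZero N] : ∑ _j : Fin N, Real.negMulLog (N : ℝ)⁻¹ = Real.log N := by
  have h := sum_negMulLog_gibbs (0 : Fin N → ℝ) 0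
  simpa [gibbs_zero] using h

theorem eq_uniform_of_log_le [NeZero N] {p : Fin N → ℝ} (hp : p ∈ stdSimplex ℝ (Fin N))
    (h : Real.log N ≤ ∑ j, Real.negMulLog (p j)) : p = fun _ => (N : ℝ)⁻¹ := by
  by_contra hne
  rw [← gibbs_zero 0] at hne
  have := sum_negMulLog_lt_log_partitionFn_add 0 0 hp hne
  simp at this
  linarith

theorem continuous_partitionFn : Continuous (partitionFn μ) := by
  unfold partitionFn; fun_prop

theorem continuous_gibbs [NeZero N] : Continuous (gibbs μ) :=
  continuous_pi fun j => Continuous.div (by fun_prop) (continuous_partitionFn μ)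
    fun γ => (partitionFn_pos μ γ).ne'

variable {μ}

/-- The log-ratio of the weights at two distinct levels determines `γ`. -/
theorem gibbs_injective [NeZero N] (hμ : ∃ i j, μ i ≠ μ j) : Function.Injective (gibbs μ) := by
  intro γ γ' h
  obtain ⟨i, j, hij⟩ := hμ
  have hi := congrArg Real.log (congrFun h i)
  have hj := congrArg Real.log (congrFun h j)
  simp only [log_gibbs] at hi hj
  have : (γ - γ') * (μ i - μ j) = 0 := by linarith
  rcases mul_eq_zero.mp this with h | h
  · linarith
  · exact absurd (by linarith) hij

/-- The entropy equation has at most one nonnegative solution. -/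
theorem gibbs_entropy_injOn [NeZero N] (hμ : ∃ i j, μ i ≠ μ j)
    {γ γ' : ℝ} (hγ : 0 ≤ γ) (hγ' : 0 ≤ γ')
    (h : Real.log (partitionFn μ γ) + γ * gibbsAverage μ γ =
      Real.log (partitionFn μ γ') + γ' * gibbsAverage μ γ') : γ = γ' := by
  by_contra hne
  have hg : gibbs μ γ ≠ gibbs μ γ' := fun h => hne (gibbs_injective hμ h)
  have h1 := sum_negMulLog_lt_log_partitionFn_add μ γ' (gibbs_mem_stdSimplex μ γ) hg
  have h2 := sum_negMulLog_lt_log_partitionFn_add μ γ (gibbs_mem_stdSimplex μ γ') hg.symm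
  rw [sum_negMulLog_gibbs, ← gibbsAverage_eq_sum] at h1 h2
  -- Equal entropies cancel the `log Z` terms, so each Gibbs state would have strictly smaller mean
  -- energy than the other; nonnegativity of both parameters allows the cancellation.
  have h3 : γ' * gibbsAverage μ γ' < γ' * gibbsAverage μ γ := by linarith
  have h4 : γ * gibbsAverage μ γ < γ * gibbsAverage μ γ' := by linarith
  have h5 := lt_of_mul_lt_mul_left h3 hγ'
  have h6 := lt_of_mul_lt_mul_left h4 hγ
  exact lt_asymm h5 h6

/-- The uniform distribution on the indices at the same level as `i₀`. -/
noncomputable def groundState (μ : Fin N → ℝ) (i₀ : Fin N) (j : Fin N) : ℝ :=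
  if μ j = μ i₀ then ((Finset.univ.filter fun j => μ j = μ i₀).card : ℝ)⁻¹ else 0

theorem card_level_pos (i₀ : Fin N) : 0 < (Finset.univ.filter fun j => μ j = μ i₀).card :=
  Finset.card_pos.mpr ⟨i₀, by simp⟩

theorem groundState_sum_comp (i₀ : Fin N) (f : ℝ → ℝ) (hf : f 0 = 0) :
    ∑ j, f (groundState μ i₀ j) = ((Finset.univ.filter fun j => μ j = μ i₀).card : ℝ) *
      f ((Finset.univ.filter fun j => μ j = μ i₀).card : ℝ)⁻¹ := by
  simp only [groundState, apply_ite f, hf, ← Finset.sum_filter, Finset.sum_const, nsmul_eq_mul]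

theorem groundState_mem_stdSimplex (i₀ : Fin N) : groundState μ i₀ ∈ stdSimplex ℝ (Fin N) := by
  refine ⟨fun j => ?_, ?_⟩
  · unfold groundState; split_ifs <;> positivity
  · have h := groundState_sum_comp (μ := μ) i₀ id rfl
    have hc : ((Finset.univ.filter fun j => μ j = μ i₀).card : ℝ) ≠ 0 :=
      Nat.cast_ne_zero.mpr (card_level_pos i₀).ne'
    simpa only [id, mul_inv_cancel₀ hc] using h

theorem sum_negMulLog_groundState (i₀ : Fin N) :
    ∑ j, Real.negMulLog (groundState μ i₀ j) =
      Real.log (Finset.univ.filter fun j => μ j = μ i₀).card := by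
  have hc : ((Finset.univ.filter fun j => μ j = μ i₀).card : ℝ) ≠ 0 :=
    Nat.cast_ne_zero.mpr (card_level_pos i₀).ne'
  rw [groundState_sum_comp i₀ _ Real.negMulLog_zero, Real.negMulLog, Real.log_inv]
  field_simp

theorem sum_mul_groundState (i₀ : Fin N) : ∑ j, μ j * groundState μ i₀ j = μ i₀ := by
  have h : ∀ j, μ j * groundState μ i₀ j = μ i₀ * groundState μ i₀ j := fun j => by
    by_cases hj : μ j = μ i₀
    · rw [hj]
    · simp [groundState, hj]
  simp only [h, ← Finset.mul_sum, (groundState_mem_stdSimplex i₀).2, mul_one]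

/-- Measured from the lowest level, each Boltzmann weight tends to the indicator of that level; the
shift cancels in the quotient. -/
theorem tendsto_gibbs_atTop {i₀ : Fin N} (h₀ : ∀ j, μ i₀ ≤ μ j) :
    Filter.Tendsto (gibbs μ) Filter.atTop (nhds (groundState μ i₀)) := by
  have hw : ∀ j, Filter.Tendsto (fun γ : ℝ => Real.exp (-γ * (μ j - μ i₀))) Filter.atTop
      (nhds (if μ j = μ i₀ then 1 else 0)) := fun j => by
    split_ifs with hj
    · simp [hj]
    · have hpos : 0 < μ j - μ i₀ := sub_pos.mpr (lt_of_le_of_ne (h₀ j) (Ne.symm hj))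
      simp only [neg_mul]
      exact Real.tendsto_exp_neg_atTop_nhds_zero.comp
        (Filter.tendsto_id.atTop_mul_const hpos)
  have hsum := tendsto_finsetSum Finset.univ fun j _ => hw j
  rw [← Finset.sum_filter, Finset.sum_const, nsmul_eq_mul, mul_one] at hsum
  have hc : ((Finset.univ.filter fun j => μ j = μ i₀).card : ℝ) ≠ 0 :=
    Nat.cast_ne_zero.mpr (card_level_pos i₀).ne'
  refine tendsto_pi_nhds.mpr fun j => ?_
  have hdiv := (hw j).div hsum hc
  have hlim : (if μ j = μ i₀ then (1 : ℝ) else 0) /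
      ((Finset.univ.filter fun j => μ j = μ i₀).card : ℝ) = groundState μ i₀ j := by
    unfold groundState; split_ifs <;> simp
  rw [hlim] at hdiv
  refine hdiv.congr fun γ => ?_
  have he : ∀ k, Real.exp (-γ * (μ k - μ i₀)) = Real.exp (-γ * μ k) * Real.exp (γ * μ i₀) :=
    fun k => by rw [← Real.exp_add]; congr 1; ring
  simp only [Pi.div_apply, he, ← Finset.sum_mul]
  rw [mul_div_mul_right _ _ (Real.exp_pos _).ne']
  rfl

/-- The entropy equation has a nonnegative solution. -/
theorem exists_gibbs_entropy_eq [NeZero N] {i₀ : Fin N} (h₀ : ∀ j, μ i₀ ≤ μ j) {s : ℝ}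
    (hs : Real.log (Finset.univ.filter fun j => μ j = μ i₀).card < s) (hs' : s ≤ Real.log N) :
    ∃ γ, 0 ≤ γ ∧ Real.log (partitionFn μ γ) + γ * gibbsAverage μ γ = s := by
  have hcont : Continuous fun γ => ∑ j, Real.negMulLog (gibbs μ γ j) :=
    continuous_sum_negMulLog.comp (continuous_gibbs μ)
  have hlim := (continuous_sum_negMulLog.tendsto _).comp (tendsto_gibbs_atTop h₀)
  rw [sum_negMulLog_groundState] at hlim
  obtain ⟨γ₁, h1, h2⟩ := ((hlim.eventually (gt_mem_nhds hs)).and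
    (Filter.eventually_ge_atTop 0)).exists
  have hzero : s ≤ ∑ j, Real.negMulLog (gibbs μ 0 j) := by
    rw [sum_negMulLog_gibbs]; simpa using hs'
  obtain ⟨γ, hγ, he⟩ := intermediate_value_Icc' h2 hcont.continuousOn ⟨h1.le, hzero⟩
  exact ⟨γ, hγ.1, by rw [← sum_negMulLog_gibbs]; exact he⟩

theorem exists_level_ne {i₀ : Fin N}
    (h : Real.log (Finset.univ.filter fun j => μ j = μ i₀).card < Real.log N) :
    ∃ i, μ i ≠ μ i₀ := by
  by_contra! hall
  simp [hall] at h

end Gibbs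

/-! ### The relaxed minimum -/

section Relaxed

variable {μ : Fin N → ℝ} {s : ℝ}

theorem isCompact_entropicSimplex : IsCompact (entropicSimplex N s) :=
  (isCompact_stdSimplex ℝ (Fin N)).inter_right
    (isClosed_le continuous_const continuous_sum_negMulLog)

theorem uniform_mem_entropicSimplex [NeZero N] (hs : s ≤ Real.log N) :
    (fun _ => (N : ℝ)⁻¹) ∈ entropicSimplex N s :=
  ⟨uniform_mem_stdSimplex N, hs.trans (sum_negMulLog_uniform N).ge⟩

theorem isLeast_relaxedJmin [NeZero N] (μ : Fin N → ℝ) (hs : s ≤ Real.log N) :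
    IsLeast ((fun p : Fin N → ℝ => ∑ j, μ j * p j) '' entropicSimplex N s)
      (relaxedJmin μ s) :=
  (isCompact_entropicSimplex.image (by fun_prop)).isLeast_sInf
    ⟨_, Set.mem_image_of_mem _ (uniform_mem_entropicSimplex hs)⟩

theorem relaxedJmin_eq_of_isLeast {x : ℝ}
    (h : IsLeast ((fun p : Fin N → ℝ => ∑ j, μ j * p j) '' entropicSimplex N s) x) :
    relaxedJmin μ s = x :=
  h.csInf_eq

theorem le_sum_mul_of_mem_stdSimplex {i₀ : Fin N} (h₀ : ∀ j, μ i₀ ≤ μ j) {p : Fin N → ℝ}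
    (hp : p ∈ stdSimplex ℝ (Fin N)) : μ i₀ ≤ ∑ j, μ j * p j := by
  calc μ i₀ = ∑ j, μ i₀ * p j := by rw [← Finset.mul_sum, hp.2, mul_one]
    _ ≤ _ := Finset.sum_le_sum fun j _ => mul_le_mul_of_nonneg_right (h₀ j) (hp.1 j)

theorem lt_gibbsAverage [NeZero N] {i₀ : Fin N} (h₀ : ∀ j, μ i₀ ≤ μ j)
    (hne : ∃ i, μ i ≠ μ i₀) (γ : ℝ) :
    μ i₀ < gibbsAverage μ γ := by
  obtain ⟨i, hi⟩ := hne
  rw [gibbsAverage_eq_sum]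
  calc μ i₀ = ∑ j, μ i₀ * gibbs μ γ j := by rw [← Finset.mul_sum, sum_gibbs, mul_one]
    _ < _ := Finset.sum_lt_sum
      (fun j _ => mul_le_mul_of_nonneg_right (h₀ j) (gibbs_pos μ γ j).le)
      ⟨i, Finset.mem_univ i,
        mul_lt_mul_of_pos_right (lt_of_le_of_ne (h₀ i) hi.symm) (gibbs_pos μ γ i)⟩

theorem relaxedJmin_eq_of_le_log_card {i₀ : Fin N} (h₀ : ∀ j, μ i₀ ≤ μ j)
    (hs : s ≤ Real.log (Finset.univ.filter fun j => μ j = μ i₀).card) :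
    relaxedJmin μ s = μ i₀ := by
  refine relaxedJmin_eq_of_isLeast ⟨⟨groundState μ i₀, ⟨groundState_mem_stdSimplex i₀, ?_⟩,
    sum_mul_groundState i₀⟩, ?_⟩
  · rwa [sum_negMulLog_groundState]
  · rintro _ ⟨p, hp, rfl⟩
    exact le_sum_mul_of_mem_stdSimplex h₀ hp.1

theorem relaxedJmin_log [NeZero N] (μ : Fin N → ℝ) :
    relaxedJmin μ (Real.log N) = (1 / (N : ℝ)) * ∑ i, μ i := by
  have huniform : ∑ j, μ j * (N : ℝ)⁻¹ = (1 / (N : ℝ)) * ∑ i, μ i := by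
    rw [← Finset.sum_mul, mul_comm, one_div]
  refine relaxedJmin_eq_of_isLeast
    ⟨⟨_, uniform_mem_entropicSimplex le_rfl, huniform⟩, ?_⟩
  rintro _ ⟨p, hp, rfl⟩
  rw [eq_uniform_of_log_le hp.1 hp.2]
  exact huniform.ge

theorem relaxedJmin_eq_gibbsAverage [NeZero N] {γ : ℝ} (hγ : 0 ≤ γ)
    (h : Real.log (partitionFn μ γ) + γ * gibbsAverage μ γ = s) :
    relaxedJmin μ s = gibbsAverage μ γ := by
  rcases hγ.eq_or_lt with rfl | hγ
  -- At `γ = 0` the variational bound says nothing about the energy, but then the only feasible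
  -- vector is uniform.
  · have hs : s = Real.log N := by simpa using h.symm
    rw [hs, relaxedJmin_log, gibbsAverage]
    simp
  · refine relaxedJmin_eq_of_isLeast ⟨⟨gibbs μ γ, ⟨gibbs_mem_stdSimplex μ γ, ?_⟩,
      (gibbsAverage_eq_sum μ γ).symm⟩, ?_⟩
    · rw [sum_negMulLog_gibbs, h]
    · rintro _ ⟨p, hp, rfl⟩
      have h1 := sum_negMulLog_le_log_partitionFn_add μ γ hp.1
      have h2 : γ * gibbsAverage μ γ ≤ γ * ∑ j, μ j * p j := by linarith [hp.2]
      exact le_of_mul_le_mul_left h2 hγ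

end Relaxed

end QPrivacy

namespace QPrivacy

/-! ### Bipartite states as matrices -/

variable {N : ℕ}

/-- The coefficients of a bipartite state, as a matrix. -/
def coeffMatrix (ψ : EuclideanSpace ℂ (Fin N × Fin N)) : Matrix (Fin N) (Fin N) ℂ :=
  Matrix.of fun i k => ψ (i, k)

/-- The bipartite state with given coefficient matrix. -/
noncomputable def stateOfMatrix (C : Matrix (Fin N) (Fin N) ℂ) :
    EuclideanSpace ℂ (Fin N × Fin N) :=
  WithLp.toLp 2 fun x => C x.1 x.2

@[simp] theorem coeffMatrix_stateOfMatrix (C : Matrix (Fin N) (Fin N) ℂ) :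
    coeffMatrix (stateOfMatrix C) = C := rfl

theorem partialTraceB_pureDensity (ψ : EuclideanSpace ℂ (Fin N × Fin N)) :
    partialTraceB (pureDensity ψ) = coeffMatrix ψ * (coeffMatrix ψ)ᴴ := by
  ext i j
  simp [partialTraceB, pureDensity, coeffMatrix, Matrix.mul_apply]

theorem mul_conjTranspose_self_apply_self (X : Matrix (Fin N) (Fin N) ℂ) (i : Fin N) :
    (X * Xᴴ) i i = ((∑ j, ‖X i j‖ ^ 2 : ℝ) : ℂ) := by
  simp [Matrix.mul_apply, Complex.mul_conj, Complex.normSq_eq_norm_sq]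

theorem transpose_mul_transpose_conjTranspose {V : Matrix (Fin N) (Fin N) ℂ}
    (hV : V ∈ Matrix.unitaryGroup (Fin N) ℂ) : Vᵀ * Vᵀᴴ = 1 := by
  have h : Vᵀᴴ = Vᴴᵀ := rfl
  rw [h, ← Matrix.transpose_mul, ← Matrix.star_eq_conjTranspose,
    Matrix.mem_unitaryGroup_iff'.mp hV, Matrix.transpose_one]

theorem transpose_conjTranspose_mul_transpose {V : Matrix (Fin N) (Fin N) ℂ}
    (hV : V ∈ Matrix.unitaryGroup (Fin N) ℂ) : Vᵀᴴ * Vᵀ = 1 :=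
  mul_eq_one_comm.mp (transpose_mul_transpose_conjTranspose hV)

/-- The diagonal of the reduced state in the basis formed by the columns of `U`. -/
noncomputable def populations (U : Matrix (Fin N) (Fin N) ℂ)
    (ψ : EuclideanSpace ℂ (Fin N × Fin N)) (i : Fin N) : ℝ :=
  ∑ j, ‖(Uᴴ * coeffMatrix ψ) i j‖ ^ 2

theorem ofReal_populations (U : Matrix (Fin N) (Fin N) ℂ)
    (ψ : EuclideanSpace ℂ (Fin N × Fin N)) (i : Fin N) :
    (populations U ψ i : ℂ) = (Uᴴ * partialTraceB (pureDensity ψ) * U) i i := by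
  rw [populations, ← mul_conjTranspose_self_apply_self, partialTraceB_pureDensity]
  simp [Matrix.mul_assoc, Matrix.conjTranspose_mul]

theorem populations_nonneg (U : Matrix (Fin N) (Fin N) ℂ)
    (ψ : EuclideanSpace ℂ (Fin N × Fin N)) (i : Fin N) : 0 ≤ populations U ψ i :=
  Finset.sum_nonneg fun _ _ => by positivity

theorem continuous_populations (U : Matrix (Fin N) (Fin N) ℂ) :
    Continuous (populations U) := by
  refine continuous_pi fun i => ?_
  simp only [populations, Matrix.mul_apply, coeffMatrix, Matrix.of_apply]
  fun_prop

/-- A unitary acting on the second factor multiplies the coefficient matrix on the right and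
preserves the row norms. -/
theorem populations_eq_sum_norm_mul_unitary (U : Matrix (Fin N) (Fin N) ℂ)
    {V : Matrix (Fin N) (Fin N) ℂ} (hV : V ∈ Matrix.unitaryGroup (Fin N) ℂ)
    (ψ : EuclideanSpace ℂ (Fin N × Fin N)) (i : Fin N) :
    ∑ j, ‖(Uᴴ * coeffMatrix ψ * Vᵀᴴ) i j‖ ^ 2 = populations U ψ i := by
  apply Complex.ofReal_injective
  rw [populations, ← mul_conjTranspose_self_apply_self, ← mul_conjTranspose_self_apply_self]
  rw [Matrix.conjTranspose_mul, Matrix.conjTranspose_conjTranspose, Matrix.mul_assoc,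
    ← Matrix.mul_assoc Vᵀᴴ, transpose_conjTranspose_mul_transpose hV, Matrix.one_mul]

theorem sum_populations {U : Matrix (Fin N) (Fin N) ℂ}
    (hU : U ∈ Matrix.unitaryGroup (Fin N) ℂ) (ψ : EuclideanSpace ℂ (Fin N × Fin N)) :
    ∑ i, populations U ψ i = ‖ψ‖ ^ 2 := by
  apply Complex.ofReal_injective
  have h1 : ((∑ i, populations U ψ i : ℝ) : ℂ) =
      (Uᴴ * partialTraceB (pureDensity ψ) * U).trace := by
    simp only [Complex.ofReal_sum, ofReal_populations, Matrix.trace, Matrix.diag_apply]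
  rw [h1, Matrix.trace_mul_cycle, ← Matrix.star_eq_conjTranspose,
    Matrix.mem_unitaryGroup_iff.mp hU, Matrix.one_mul, partialTraceB_pureDensity,
    EuclideanSpace.norm_sq_eq, Fintype.sum_prod_type]
  simp only [Matrix.trace, Matrix.diag_apply, mul_conjTranspose_self_apply_self,
    ← Complex.ofReal_sum]
  rfl

theorem populations_mem_stdSimplex {U : Matrix (Fin N) (Fin N) ℂ}
    (hU : U ∈ Matrix.unitaryGroup (Fin N) ℂ) {ψ : EuclideanSpace ℂ (Fin N × Fin N)}
    (hψ : ‖ψ‖ = 1) : populations U ψ ∈ stdSimplex ℝ (Fin N) :=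
  ⟨populations_nonneg U ψ, by rw [sum_populations hU, hψ, one_pow]⟩

/-! ### Entanglement entropy -/

theorem isHermitian_eq_unitary_mul_diagonal {K : Matrix (Fin N) (Fin N) ℂ}
    (hK : K.IsHermitian) :
    K = hK.eigenvectorUnitary * Matrix.diagonal (fun i => (hK.eigenvalues i : ℂ)) *
      (hK.eigenvectorUnitary : Matrix (Fin N) (Fin N) ℂ)ᴴ := by
  conv_lhs => rw [hK.spectral_theorem, Unitary.conjStarAlgAut_apply]
  rfl

theorem populations_eigenvectorUnitary (ψ : EuclideanSpace ℂ (Fin N × Fin N)) (i : Fin N) :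
    populations (reducedState_isHermitian ψ).eigenvectorUnitary ψ i =
      (reducedState_isHermitian ψ).eigenvalues i := by
  apply Complex.ofReal_injective
  have h := (reducedState_isHermitian ψ).conjStarAlgAut_star_eigenvectorUnitary
  rw [Unitary.conjStarAlgAut_star_apply] at h
  rw [ofReal_populations, ← Matrix.star_eq_conjTranspose, h]
  simp

theorem entanglementEntropy_eq_sum_populations (ψ : EuclideanSpace ℂ (Fin N × Fin N)) :
    entanglementEntropy ψ = ∑ i, Real.negMulLog
      (populations (reducedState_isHermitian ψ).eigenvectorUnitary ψ i) := by
  simp only [populations_eigenvectorUnitary]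
  rfl

theorem unitary_sum_norm_sq_row {W : Matrix (Fin N) (Fin N) ℂ}
    (hW : W ∈ Matrix.unitaryGroup (Fin N) ℂ) (i : Fin N) : ∑ k, ‖W i k‖ ^ 2 = 1 := by
  apply Complex.ofReal_injective
  rw [← mul_conjTranspose_self_apply_self, ← Matrix.star_eq_conjTranspose,
    Matrix.mem_unitaryGroup_iff.mp hW]
  simp

theorem unitary_sum_norm_sq_col {W : Matrix (Fin N) (Fin N) ℂ}
    (hW : W ∈ Matrix.unitaryGroup (Fin N) ℂ) (k : Fin N) : ∑ i, ‖W i k‖ ^ 2 = 1 := by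
  have h := unitary_sum_norm_sq_row (Unitary.star_mem hW) k
  simpa [Matrix.star_apply] using h

/-- The squared moduli of the entries of the change-of-basis unitary are the weights used below in
Jensen's inequality. -/
theorem populations_eq_sum_eigenvalues (U : Matrix (Fin N) (Fin N) ℂ)
    (ψ : EuclideanSpace ℂ (Fin N × Fin N)) (i : Fin N) :
    populations U ψ i = ∑ k,
      ‖(Uᴴ * (reducedState_isHermitian ψ).eigenvectorUnitary : Matrix (Fin N) (Fin N) ℂ) i k‖ ^ 2 *
        (reducedState_isHermitian ψ).eigenvalues k := by
  apply Complex.ofReal_injective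
  set W : Matrix (Fin N) (Fin N) ℂ := (reducedState_isHermitian ψ).eigenvectorUnitary.1 with hW
  have h : Uᴴ * partialTraceB (pureDensity ψ) * U = (Uᴴ * W) *
      Matrix.diagonal (fun i => ((reducedState_isHermitian ψ).eigenvalues i : ℂ)) *
      (Uᴴ * W)ᴴ := by
    conv_lhs => rw [isHermitian_eq_unitary_mul_diagonal (reducedState_isHermitian ψ)]
    simp [Matrix.mul_assoc, Matrix.conjTranspose_mul, hW]
  rw [ofReal_populations, h, Matrix.mul_apply]
  push_cast
  refine Finset.sum_congr rfl fun k _ => ?_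
  rw [Matrix.mul_diagonal, Matrix.conjTranspose_apply, ← Complex.ofReal_pow,
    ← Complex.normSq_eq_norm_sq, ← Complex.mul_conj]
  simp only [RCLike.star_def]
  ring

/-- The von Neumann entropy is at most the Shannon entropy of the diagonal in any basis. -/
theorem entanglementEntropy_le_sum_populations {U : Matrix (Fin N) (Fin N) ℂ}
    (hU : U ∈ Matrix.unitaryGroup (Fin N) ℂ) (ψ : EuclideanSpace ℂ (Fin N × Fin N)) :
    entanglementEntropy ψ ≤ ∑ i, Real.negMulLog (populations U ψ i) := by
  set W : Matrix (Fin N) (Fin N) ℂ := (reducedState_isHermitian ψ).eigenvectorUnitary.1 with hW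
  set lam := (reducedState_isHermitian ψ).eigenvalues with hlam
  have hlam0 : ∀ k, 0 ≤ lam k := fun k => by
    rw [hlam, ← populations_eigenvectorUnitary]; exact populations_nonneg _ _ _
  have hUW : Uᴴ * W ∈ Matrix.unitaryGroup (Fin N) ℂ :=
    mul_mem (Unitary.star_mem hU) (reducedState_isHermitian ψ).eigenvectorUnitary.2
  calc entanglementEntropy ψ = ∑ k, Real.negMulLog (lam k) := rfl
    _ = ∑ k, (∑ i, ‖(Uᴴ * W) i k‖ ^ 2) * Real.negMulLog (lam k) := by
        simp only [unitary_sum_norm_sq_col hUW, one_mul]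
    _ = ∑ i, ∑ k, ‖(Uᴴ * W) i k‖ ^ 2 • Real.negMulLog (lam k) := by
        simp only [Finset.sum_mul, smul_eq_mul]
        exact Finset.sum_comm
    -- Jensen for each row, whose weights sum to one; the column sums were used to insert the
    -- weights above.
    _ ≤ ∑ i, Real.negMulLog (∑ k, ‖(Uᴴ * W) i k‖ ^ 2 • lam k) :=
        Finset.sum_le_sum fun i _ => Real.concaveOn_negMulLog.le_map_sum
          (fun k _ => by positivity) (unitary_sum_norm_sq_row hUW i) fun k _ => hlam0 k
    _ = _ := Finset.sum_congr rfl fun i _ => by rw [populations_eq_sum_eigenvalues]; rfl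

theorem entanglementEntropy_nonneg {ψ : EuclideanSpace ℂ (Fin N × Fin N)} (hψ : ‖ψ‖ = 1) :
    0 ≤ entanglementEntropy ψ := by
  rw [entanglementEntropy_eq_sum_populations]
  exact sum_negMulLog_nonneg (populations_mem_stdSimplex (Subtype.prop _) hψ)

/-- The von Neumann entropy is the minimum over all bases of the Shannon entropy of the diagonal,
attained in an eigenbasis. The constraint is thus an intersection of closed conditions, and
continuity of eigenvalues is not needed. -/
theorem isCompact_entangledStates (s : ℝ) : IsCompact (entangledStates N s) := by
  have h : entangledStates N s = Metric.sphere 0 1 ∩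
      ⋂ U : Matrix.unitaryGroup (Fin N) ℂ,
        {ψ | s ≤ ∑ i, Real.negMulLog (populations (U : Matrix (Fin N) (Fin N) ℂ) ψ i)} := by
    ext ψ
    simp only [entangledStates, Set.mem_ofPred_eq, Set.mem_inter_iff, mem_sphere_zero_iff_norm,
      Set.mem_iInter]
    refine and_congr_right fun _ => ⟨fun hs U =>
      hs.trans (entanglementEntropy_le_sum_populations U.2 ψ), fun hs => ?_⟩
    rw [entanglementEntropy_eq_sum_populations]
    exact hs _
  rw [h]
  refine (isCompact_sphere _ _).inter_right (isClosed_iInter fun U => ?_)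
  exact isClosed_le continuous_const
    (continuous_sum_negMulLog.comp (continuous_populations (U : Matrix (Fin N) (Fin N) ℂ)))

/-- A state with maximally mixed reduction is a unit vector of entanglement entropy `log N`. -/
theorem mem_entangledStates_of_reducedState [NeZero N] {ψ : EuclideanSpace ℂ (Fin N × Fin N)}
    (h : partialTraceB (pureDensity ψ) = (N : ℂ)⁻¹ • 1) :
    ψ ∈ entangledStates N (Real.log N) := by
  have hpop : ∀ U ∈ Matrix.unitaryGroup (Fin N) ℂ, populations U ψ = fun _ => (N : ℝ)⁻¹ := by
    intro U hU
    ext i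
    apply Complex.ofReal_injective
    rw [ofReal_populations, h]
    simp [← Matrix.star_eq_conjTranspose, Matrix.mem_unitaryGroup_iff'.mp hU]
  constructor
  · have h1 := sum_populations (one_mem (Matrix.unitaryGroup (Fin N) ℂ)) ψ
    rw [hpop 1 (one_mem _), (uniform_mem_stdSimplex N).2] at h1
    exact (sq_eq_sq₀ (norm_nonneg _) zero_le_one).mp (by rw [← h1, one_pow])
  · rw [entanglementEntropy_eq_sum_populations, hpop _ (Subtype.prop _),
      sum_negMulLog_uniform]

/-- Only the uniform spectrum reaches entropy `log N`, and a Hermitian matrix with constant spectrum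
is scalar. -/
theorem reducedState_of_mem_entangledStates [NeZero N]
    {ψ : EuclideanSpace ℂ (Fin N × Fin N)} (h : ψ ∈ entangledStates N (Real.log N)) :
    partialTraceB (pureDensity ψ) = (N : ℂ)⁻¹ • 1 := by
  have h2 := h.2
  rw [entanglementEntropy_eq_sum_populations] at h2
  have hpop := eq_uniform_of_log_le (populations_mem_stdSimplex (Subtype.prop _) h.1) h2
  have hev : ∀ i, (reducedState_isHermitian ψ).eigenvalues i = (N : ℝ)⁻¹ := fun i => by
    rw [← populations_eigenvectorUnitary, hpop]
  rw [isHermitian_eq_unitary_mul_diagonal (reducedState_isHermitian ψ)]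
  have hd : Matrix.diagonal (fun i => ((reducedState_isHermitian ψ).eigenvalues i : ℂ)) =
      (N : ℂ)⁻¹ • 1 := by
    rw [Matrix.smul_one_eq_diagonal]; simp [hev]
  rw [hd, Matrix.mul_smul, Matrix.smul_mul, Matrix.mul_one, ← Matrix.star_eq_conjTranspose,
    Matrix.mem_unitaryGroup_iff.mp (Subtype.prop _)]

/-! ### Energy of a product observable -/

theorem continuous_energy (K : Matrix (Fin N × Fin N) (Fin N × Fin N) ℂ) :
    Continuous (energy K) := by
  unfold energy dotProduct Matrix.mulVec dotProduct
  simp only [Pi.star_apply]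
  fun_prop

/-- The second factor acts through its transpose, which is why `Vᵀ` and `Vᵀᴴ` appear throughout. -/
theorem kronecker_mulVec_coeffMatrix (A B : Matrix (Fin N) (Fin N) ℂ)
    (ψ : EuclideanSpace ℂ (Fin N × Fin N)) (i k : Fin N) :
    (Matrix.kronecker A B *ᵥ ψ.ofLp) (i, k) = (A * coeffMatrix ψ * Bᵀ) i k := by
  simp only [Matrix.mulVec, dotProduct, Fintype.sum_prod_type, Matrix.mul_apply, Finset.sum_mul,
    Matrix.kronecker, Matrix.kroneckerMap_apply, coeffMatrix, Matrix.of_apply,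
    Matrix.transpose_apply]
  rw [Finset.sum_comm]
  exact Finset.sum_congr rfl fun _ _ => Finset.sum_congr rfl fun _ _ => by ring

theorem energy_kronecker_eq_trace (A B : Matrix (Fin N) (Fin N) ℂ)
    (ψ : EuclideanSpace ℂ (Fin N × Fin N)) :
    energy (Matrix.kronecker A B) ψ =
      ((coeffMatrix ψ)ᴴ * (A * coeffMatrix ψ * Bᵀ)).trace.re := by
  rw [energy, dotProduct, Fintype.sum_prod_type, Finset.sum_comm]
  simp only [kronecker_mulVec_coeffMatrix, Matrix.trace, Matrix.diag_apply]
  rfl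

/-- The energy in product eigenbases of the two local observables. -/
theorem energy_kronecker_diagonal (U V : Matrix (Fin N) (Fin N) ℂ) (α β : Fin N → ℝ)
    (ψ : EuclideanSpace ℂ (Fin N × Fin N)) :
    energy (Matrix.kronecker (U * Matrix.diagonal (fun i => (α i : ℂ)) * Uᴴ)
      (V * Matrix.diagonal (fun i => (β i : ℂ)) * Vᴴ)) ψ =
      ∑ i, ∑ j, α i * β j * ‖(Uᴴ * coeffMatrix ψ * Vᵀᴴ) i j‖ ^ 2 := by
  set C := Uᴴ * coeffMatrix ψ * Vᵀᴴ with hC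
  have h : ((coeffMatrix ψ)ᴴ * (U * Matrix.diagonal (fun i => (α i : ℂ)) * Uᴴ * coeffMatrix ψ *
      (V * Matrix.diagonal (fun i => (β i : ℂ)) * Vᴴ)ᵀ)).trace =
      (Cᴴ * (Matrix.diagonal (fun i => (α i : ℂ)) * C *
        Matrix.diagonal (fun i => (β i : ℂ)))).trace := by
    have hV : Vᴴᵀ = Vᵀᴴ := rfl
    rw [Matrix.transpose_mul, Matrix.transpose_mul, Matrix.diagonal_transpose, hV]
    have h1 : (coeffMatrix ψ)ᴴ * (U * Matrix.diagonal (fun i => (α i : ℂ)) * Uᴴ * coeffMatrix ψ *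
        (Vᵀᴴ * (Matrix.diagonal (fun i => (β i : ℂ)) * Vᵀ))) =
        ((coeffMatrix ψ)ᴴ * U * (Matrix.diagonal (fun i => (α i : ℂ)) * C *
          Matrix.diagonal (fun i => (β i : ℂ)))) * Vᵀ := by
      simp only [hC, Matrix.mul_assoc]
    rw [h1, Matrix.trace_mul_comm]
    simp only [hC, Matrix.conjTranspose_mul, Matrix.conjTranspose_conjTranspose,
      Matrix.mul_assoc]
  rw [energy_kronecker_eq_trace, h, Finset.sum_comm, Matrix.trace, Complex.re_sum]
  refine Finset.sum_congr rfl fun j _ => ?_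
  rw [Matrix.diag_apply, Matrix.mul_apply, Complex.re_sum]
  refine Finset.sum_congr rfl fun i _ => ?_
  rw [Matrix.mul_diagonal, Matrix.diagonal_mul, Matrix.conjTranspose_apply]
  have : star (C i j) * ((α i : ℂ) * C i j * (β j : ℂ)) =
      ((α i * β j * ‖C i j‖ ^ 2 : ℝ) : ℂ) := by
    push_cast
    rw [← Complex.ofReal_pow, ← Complex.normSq_eq_norm_sq, ← Complex.mul_conj]
    simp only [RCLike.star_def]
    ring
  rw [this, Complex.ofReal_re]

/-! ### Ordered eigenvalues -/

theorem sortedEigenvalues_antitone {K : Matrix (Fin N) (Fin N) ℂ} (hK : K.IsHermitian) :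
    Antitone (sortedEigenvalues hK) :=
  fun _ _ h => hK.eigenvalues₀_antitone (Fin.cast_le_cast _ |>.mpr h)

theorem exists_perm_sortedEigenvalues {K : Matrix (Fin N) (Fin N) ℂ} (hK : K.IsHermitian) :
    ∃ σ : Equiv.Perm (Fin N), ∀ i, sortedEigenvalues hK i = hK.eigenvalues (σ i) :=
  ⟨(finCongr (Fintype.card_fin N).symm).trans (Fintype.equivOfCardEq (Fintype.card_fin _)),
    fun i => by simp [sortedEigenvalues, Matrix.IsHermitian.eigenvalues]⟩

theorem exists_unitary_sortedEigenvalues {K : Matrix (Fin N) (Fin N) ℂ} (hK : K.IsHermitian) :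
    ∃ U ∈ Matrix.unitaryGroup (Fin N) ℂ,
      K = U * Matrix.diagonal (fun i => (sortedEigenvalues hK i : ℂ)) * Uᴴ := by
  obtain ⟨σ, hσ⟩ := exists_perm_sortedEigenvalues hK
  set W : Matrix (Fin N) (Fin N) ℂ := hK.eigenvectorUnitary.1 with hW
  -- Sorting the eigenvalues amounts to permuting the eigenvector columns.
  refine ⟨W.submatrix id σ, ?_, ?_⟩
  · rw [Matrix.mem_unitaryGroup_iff, Matrix.star_eq_conjTranspose,
      Matrix.conjTranspose_submatrix, Matrix.submatrix_mul_equiv,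
      ← Matrix.star_eq_conjTranspose, Matrix.mem_unitaryGroup_iff.mp (Subtype.prop _),
      Matrix.submatrix_id_id]
  · have hd : Matrix.diagonal (fun i => (sortedEigenvalues hK i : ℂ)) =
        (Matrix.diagonal (fun i => (hK.eigenvalues i : ℂ))).submatrix σ σ := by
      rw [Matrix.submatrix_diagonal_equiv]
      congr 1
      ext i
      simp [hσ]
    rw [hd, Matrix.conjTranspose_submatrix, Matrix.submatrix_mul_equiv,
      Matrix.submatrix_mul_equiv, Matrix.submatrix_id_id]
    exact isHermitian_eq_unitary_mul_diagonal hK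

theorem sortedEigenvalues_nonneg {K : Matrix (Fin N) (Fin N) ℂ} (hK : K.IsHermitian)
    (hpos : K.PosSemidef) (i : Fin N) : 0 ≤ sortedEigenvalues hK i := by
  obtain ⟨σ, hσ⟩ := exists_perm_sortedEigenvalues hK
  rw [hσ]
  exact hpos.eigenvalues_nonneg _

theorem localObservable_posSemidef {O : Type*} [Fintype O] (E : Channel N) (M : POVM N O)
    (a : O) : (localObservable E M a).PosSemidef :=
  Matrix.posSemidef_sum _ fun k _ => (M.posSemidef a).conjTranspose_mul_mul_same (E.kraus k)

/-! ### Rearrangement for doubly stochastic matrices -/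

/-- The right side is linear in `D`, so Birkhoff's theorem reduces it to permutation matrices, where
it is the rearrangement inequality. -/
theorem sum_mul_rev_le_of_mem_doublyStochastic {D : Matrix (Fin N) (Fin N) ℝ}
    (hD : D ∈ doublyStochastic ℝ (Fin N)) {α β : Fin N → ℝ} (hα : Antitone α)
    (hβ : Antitone β) :
    ∑ i, α i * β (Fin.rev i) ≤ ∑ i, ∑ j, α i * β j * D i j := by
  obtain ⟨w, hw0, hw1, rfl⟩ := exists_eq_sum_perm_of_mem_doublyStochastic hD
  have hanti : Antivary α fun i => β (Fin.rev i) :=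
    hα.antivary fun i j h => hβ (Fin.rev_le_rev.mpr h)
  have hperm : ∀ σ : Equiv.Perm (Fin N), ∑ i, α i * β (Fin.rev i) ≤ ∑ i, α i * β (σ i) :=
    fun σ => by
      -- Composing `σ` with the reversal cancels the reversal built into the antivarying family.
      have h := hanti.sum_mul_le_sum_mul_comp_perm (σ := σ.trans Fin.revPerm)
      simpa using h
  calc ∑ i, α i * β (Fin.rev i) = ∑ σ, w σ * ∑ i, α i * β (Fin.rev i) := by
        rw [← Finset.sum_mul, hw1, one_mul]
    _ ≤ ∑ σ, w σ * ∑ i, α i * β (σ i) :=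
        Finset.sum_le_sum fun σ _ => mul_le_mul_of_nonneg_left (hperm σ) (hw0 σ)
    _ = _ := by
        simp only [Finset.mul_sum, Matrix.sum_apply, Matrix.smul_apply, smul_eq_mul]
        rw [Finset.sum_comm]
        refine Finset.sum_congr rfl fun i _ => ?_
        rw [Finset.sum_comm]
        refine Finset.sum_congr rfl fun σ _ => ?_
        simp [Equiv.Perm.permMatrix, PEquiv.toMatrix_apply, Equiv.toPEquiv_apply]
        ring

/-! ### Minimal energy of a product observable -/

section ProductObservable

theorem coeff_stateOfMatrix_mul {U V : Matrix (Fin N) (Fin N) ℂ}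
    (hU : U ∈ Matrix.unitaryGroup (Fin N) ℂ) (hV : V ∈ Matrix.unitaryGroup (Fin N) ℂ)
    (C : Matrix (Fin N) (Fin N) ℂ) :
    Uᴴ * coeffMatrix (stateOfMatrix (U * C * Vᵀ)) * Vᵀᴴ = C := by
  rw [coeffMatrix_stateOfMatrix, Matrix.mul_assoc, Matrix.mul_assoc,
    transpose_mul_transpose_conjTranspose hV, Matrix.mul_one, ← Matrix.mul_assoc,
    ← Matrix.star_eq_conjTranspose, Matrix.mem_unitaryGroup_iff'.mp hU, Matrix.one_mul]

theorem norm_sq_stateOfMatrix_mul {U V : Matrix (Fin N) (Fin N) ℂ}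
    (hU : U ∈ Matrix.unitaryGroup (Fin N) ℂ) (hV : V ∈ Matrix.unitaryGroup (Fin N) ℂ)
    (C : Matrix (Fin N) (Fin N) ℂ) :
    ‖stateOfMatrix (U * C * Vᵀ)‖ ^ 2 = ∑ i, ∑ j, ‖C i j‖ ^ 2 := by
  simp only [← sum_populations hU, ← populations_eq_sum_norm_mul_unitary U hV,
    coeff_stateOfMatrix_mul hU hV]

variable {K : Matrix (Fin N × Fin N) (Fin N × Fin N) ℂ} {U V : Matrix (Fin N) (Fin N) ℂ}
  {α β : Fin N → ℝ}

theorem sum_mul_populations_le_energy (hV : V ∈ Matrix.unitaryGroup (Fin N) ℂ)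
    (hK : K = Matrix.kronecker (U * Matrix.diagonal (fun i => (α i : ℂ)) * Uᴴ)
      (V * Matrix.diagonal (fun i => (β i : ℂ)) * Vᴴ))
    (hα : ∀ i, 0 ≤ α i) {k : Fin N} (hβ : ∀ j, β k ≤ β j)
    (ψ : EuclideanSpace ℂ (Fin N × Fin N)) :
    ∑ i, α i * β k * populations U ψ i ≤ energy K ψ := by
  rw [hK, energy_kronecker_diagonal]
  refine Finset.sum_le_sum fun i _ => ?_
  rw [← populations_eq_sum_norm_mul_unitary U hV, Finset.mul_sum]
  refine Finset.sum_le_sum fun j _ => mul_le_mul_of_nonneg_right ?_ (by positivity)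
  exact mul_le_mul_of_nonneg_left (hβ j) (hα i)

/-- A product of eigenvectors realizes each product of eigenvalues as an energy. -/
theorem exists_mem_entangledStates_energy_eq_mul (hU : U ∈ Matrix.unitaryGroup (Fin N) ℂ)
    (hV : V ∈ Matrix.unitaryGroup (Fin N) ℂ)
    (hK : K = Matrix.kronecker (U * Matrix.diagonal (fun i => (α i : ℂ)) * Uᴴ)
      (V * Matrix.diagonal (fun i => (β i : ℂ)) * Vᴴ)) (k l : Fin N) :
    ∃ ψ ∈ entangledStates N 0, energy K ψ = α k * β l := by
  have hC : ∀ i j, ‖Matrix.single k l (1 : ℂ) i j‖ ^ 2 =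
      if k = i then if l = j then (1 : ℝ) else 0 else 0 := fun i j => by
    rw [Matrix.single_apply]
    by_cases h : k = i <;> by_cases h' : l = j <;> simp [h, h']
  have hn : ‖stateOfMatrix (U * Matrix.single k l 1 * Vᵀ)‖ = 1 := by
    refine (sq_eq_sq₀ (norm_nonneg _) zero_le_one).mp ?_
    rw [norm_sq_stateOfMatrix_mul hU hV]
    simp only [hC]
    simp
  refine ⟨stateOfMatrix (U * Matrix.single k l 1 * Vᵀ),
    ⟨hn, entanglementEntropy_nonneg hn⟩, ?_⟩
  rw [hK, energy_kronecker_diagonal, coeff_stateOfMatrix_mul hU hV]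
  simp only [hC]
  simp

variable [NeZero N]

/-- The maximally entangled state pairing the two eigenbases in opposite orders. -/
theorem exists_mem_entangledStates_energy_eq_sum_rev (hU : U ∈ Matrix.unitaryGroup (Fin N) ℂ)
    (hV : V ∈ Matrix.unitaryGroup (Fin N) ℂ)
    (hK : K = Matrix.kronecker (U * Matrix.diagonal (fun i => (α i : ℂ)) * Uᴴ)
      (V * Matrix.diagonal (fun i => (β i : ℂ)) * Vᴴ)) :
    ∃ ψ ∈ entangledStates N (Real.log N),
      energy K ψ = (1 / (N : ℝ)) * ∑ i, α i * β (Fin.rev i) := by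
  -- Amplitudes `1 / √N` on the antidiagonal give `C * Cᴴ = 1 / N` and pair each `α i` with `β
  -- (Fin.rev i)`.
  set C : Matrix (Fin N) (Fin N) ℂ :=
    Matrix.of fun i j => if j = Fin.rev i then ((Real.sqrt N)⁻¹ : ℂ) else 0 with hC
  have hCC : C * Cᴴ = (N : ℂ)⁻¹ • 1 := by
    ext i j
    have hN : ((Real.sqrt N : ℂ))⁻¹ * (Real.sqrt N : ℂ)⁻¹ = (N : ℂ)⁻¹ := by
      rw [← mul_inv, ← Complex.ofReal_mul, Real.mul_self_sqrt (Nat.cast_nonneg _)]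
      simp
    by_cases hij : i = j
    · subst hij
      simp [Matrix.mul_apply, hC, hN]
    · simp [Matrix.mul_apply, hC, hij]
  have hCn : ∀ i j, ‖C i j‖ ^ 2 = if j = Fin.rev i then (N : ℝ)⁻¹ else 0 := fun i j => by
    simp only [hC, Matrix.of_apply]
    split_ifs
    · simp [abs_of_nonneg (Real.sqrt_nonneg _)]
    · simp
  refine ⟨stateOfMatrix (U * C * Vᵀ), mem_entangledStates_of_reducedState ?_, ?_⟩
  · rw [partialTraceB_pureDensity, coeffMatrix_stateOfMatrix, Matrix.conjTranspose_mul,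
      Matrix.mul_assoc, ← Matrix.mul_assoc Vᵀ, transpose_mul_transpose_conjTranspose hV,
      Matrix.one_mul, Matrix.conjTranspose_mul, Matrix.mul_assoc, ← Matrix.mul_assoc C, hCC,
      Matrix.smul_mul, Matrix.mul_smul, Matrix.one_mul, ← Matrix.star_eq_conjTranspose,
      Matrix.mem_unitaryGroup_iff.mp hU]
  · rw [hK, energy_kronecker_diagonal, coeff_stateOfMatrix_mul hU hV]
    simp only [hCn, mul_ite, mul_zero, Finset.sum_ite_eq', Finset.mem_univ, if_true,
      ← Finset.sum_mul]
    ring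

theorem sum_rev_le_energy (hU : U ∈ Matrix.unitaryGroup (Fin N) ℂ)
    (hV : V ∈ Matrix.unitaryGroup (Fin N) ℂ)
    (hK : K = Matrix.kronecker (U * Matrix.diagonal (fun i => (α i : ℂ)) * Uᴴ)
      (V * Matrix.diagonal (fun i => (β i : ℂ)) * Vᴴ))
    (hα : Antitone α) (hβ : Antitone β) {ψ : EuclideanSpace ℂ (Fin N × Fin N)}
    (hψ : ψ ∈ entangledStates N (Real.log N)) :
    (1 / (N : ℝ)) * ∑ i, α i * β (Fin.rev i) ≤ energy K ψ := by
  have hN : (N : ℝ) ≠ 0 := Nat.cast_ne_zero.mpr (NeZero.ne N)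
  have hNC : (N : ℂ) ≠ 0 := Nat.cast_ne_zero.mpr (NeZero.ne N)
  set C := Uᴴ * coeffMatrix ψ * Vᵀᴴ with hC
  have hρ := reducedState_of_mem_entangledStates hψ
  rw [partialTraceB_pureDensity] at hρ
  have hCC : C * Cᴴ = (N : ℂ)⁻¹ • 1 := by
    rw [hC, Matrix.conjTranspose_mul, Matrix.conjTranspose_conjTranspose, Matrix.mul_assoc,
      ← Matrix.mul_assoc Vᵀᴴ, transpose_conjTranspose_mul_transpose hV, Matrix.one_mul,
      Matrix.conjTranspose_mul, Matrix.conjTranspose_conjTranspose, Matrix.mul_assoc,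
      ← Matrix.mul_assoc (coeffMatrix ψ), hρ, Matrix.smul_mul, Matrix.mul_smul, Matrix.one_mul,
      ← Matrix.star_eq_conjTranspose, Matrix.mem_unitaryGroup_iff'.mp hU]
  -- The reduced state controls only the row sums; the column sums follow because a one-sided
  -- inverse of a square matrix is two-sided.
  have hCC' : Cᴴ * C = (N : ℂ)⁻¹ • 1 := by
    have h1 : ((N : ℂ) • C) * Cᴴ = 1 := by
      rw [Matrix.smul_mul, hCC, smul_smul, mul_inv_cancel₀ hNC, one_smul]
    have h2 := mul_eq_one_comm.mp h1
    rw [Matrix.mul_smul] at h2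
    rw [← h2, smul_smul, inv_mul_cancel₀ hNC, one_smul]
  have hrow : ∀ i, ∑ j, ‖C i j‖ ^ 2 = (N : ℝ)⁻¹ := fun i => by
    apply Complex.ofReal_injective
    rw [← mul_conjTranspose_self_apply_self, hCC]
    simp
  have hcol : ∀ j, ∑ i, ‖C i j‖ ^ 2 = (N : ℝ)⁻¹ := fun j => by
    have h := mul_conjTranspose_self_apply_self Cᴴ j
    rw [Matrix.conjTranspose_conjTranspose, hCC'] at h
    apply Complex.ofReal_injective
    simpa using h.symm
  have hD : (Matrix.of fun i j => (N : ℝ) * ‖C i j‖ ^ 2) ∈ doublyStochastic ℝ (Fin N) := by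
    rw [mem_doublyStochastic_iff_sum]
    refine ⟨fun i j => by simp only [Matrix.of_apply]; positivity, fun i => ?_, fun j => ?_⟩
    · simp only [Matrix.of_apply, ← Finset.mul_sum, hrow, mul_inv_cancel₀ hN]
    · simp only [Matrix.of_apply, ← Finset.mul_sum, hcol, mul_inv_cancel₀ hN]
  have h := sum_mul_rev_le_of_mem_doublyStochastic hD hα hβ
  rw [hK, energy_kronecker_diagonal, ← hC]
  calc (1 / (N : ℝ)) * ∑ i, α i * β (Fin.rev i)
      ≤ (1 / (N : ℝ)) * ∑ i, ∑ j, α i * β j * ((N : ℝ) * ‖C i j‖ ^ 2) :=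
        mul_le_mul_of_nonneg_left h (by positivity)
    _ = _ := by
        simp only [Finset.mul_sum]
        exact Finset.sum_congr rfl fun i _ => Finset.sum_congr rfl fun j _ => by
          field_simp

end ProductObservable

theorem isLeast_Jmin (K : Matrix (Fin N × Fin N) (Fin N × Fin N) ℂ) {s : ℝ}
    (hne : (entangledStates N s).Nonempty) :
    IsLeast (energy K '' entangledStates N s) (Jmin K s) :=
  ((isCompact_entangledStates s).image (continuous_energy K)).isLeast_sInf (hne.image _)

theorem entangledStates_anti {s t : ℝ} (h : t ≤ s) :
    entangledStates N s ⊆ entangledStates N t :=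
  fun _ hψ => ⟨hψ.1, h.trans hψ.2⟩

end QPrivacy

/-! ### Proof of the theorem -/

open QPrivacy in
theorem mainTheorem3 {N : ℕ} [NeZero N] {OA OB : Type*} [Fintype OA] [Fintype OB]
    (EA EB : Channel N) (MA : POVM N OA) (MB : POVM N OB) (a : OA) (b : OB)
    (K : Matrix (Fin N × Fin N) (Fin N × Fin N) ℂ)
    (hK : K = Matrix.kronecker (localObservable EA MA a) (localObservable EB MB b))
    (α β μ : Fin N → ℝ)
    (hα : α = sortedEigenvalues (localObservable_isHermitian EA MA a))
    (hβ : β = sortedEigenvalues (localObservable_isHermitian EB MB b))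
    -- `Fin.rev 0` is the last index; `Fin.rev i` is the index `N - i + 1` in one-based counting
    (hμ : ∀ i, μ i = α i * β (Fin.rev 0))
    (dmin : ℕ) (hdmin : dmin = (Finset.univ.filter fun j => μ j = μ (Fin.rev 0)).card)
    (s : ℝ) (hs : s ≤ Real.log N) :
    -- both minima are attained, and the lowest level is the unconstrained minimal energy
    IsLeast (energy K '' entangledStates N s) (Jmin K s) ∧
    IsLeast ((fun p : Fin N → ℝ => ∑ j, μ j * p j) '' entropicSimplex N s) (relaxedJmin μ s) ∧
    μ (Fin.rev 0) = sigmaMin K ∧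
    -- the relaxed value is a lower bound
    relaxedJmin μ s ≤ Jmin K s ∧
    -- low-entanglement regime
    (s ≤ Real.log dmin → relaxedJmin μ s = sigmaMin K) ∧
    -- high-entanglement regime
    (Real.log dmin < s →
      ∃ γ : ℝ, 0 ≤ γ ∧ (s < Real.log N → 0 < γ) ∧
        Real.log (partitionFn μ γ) + γ * gibbsAverage μ γ = s ∧
        (∀ γ' : ℝ, 0 ≤ γ' →
          Real.log (partitionFn μ γ') + γ' * gibbsAverage μ γ' = s → γ' = γ) ∧
        relaxedJmin μ s = gibbsAverage μ γ ∧
        sigmaMin K < relaxedJmin μ s) ∧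
    -- maximal-entanglement regime
    (s = Real.log N →
      Jmin K s = (1 / (N : ℝ)) * ∑ i, α i * β (Fin.rev i) ∧
      relaxedJmin μ s = (1 / (N : ℝ)) * ∑ i, μ i ∧
      ∀ t : ℝ, t ≤ Real.log N → Jmin K t ≤ Jmin K s) := by
  have hα0 : ∀ i, 0 ≤ α i := fun i => by
    rw [hα]; exact sortedEigenvalues_nonneg _ (localObservable_posSemidef EA MA a) i
  have hβ0 : ∀ i, 0 ≤ β i := fun i => by
    rw [hβ]; exact sortedEigenvalues_nonneg _ (localObservable_posSemidef EB MB b) i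
  have hαanti : Antitone α := hα ▸ sortedEigenvalues_antitone _
  have hβanti : Antitone β := hβ ▸ sortedEigenvalues_antitone _
  obtain ⟨U, hU, hUK⟩ := exists_unitary_sortedEigenvalues (localObservable_isHermitian EA MA a)
  obtain ⟨V, hV, hVK⟩ := exists_unitary_sortedEigenvalues (localObservable_isHermitian EB MB b)
  rw [← hα] at hUK
  rw [← hβ] at hVK
  rw [hUK, hVK] at hK
  have hlast : ∀ j : Fin N, j ≤ Fin.rev 0 := fun j =>
    Fin.le_rev_iff.mpr (Fin.zero_le _)
  have hμmin : ∀ j, μ (Fin.rev 0) ≤ μ j := fun j => by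
    rw [hμ, hμ]
    exact mul_le_mul_of_nonneg_right (hαanti (hlast j)) (hβ0 _)
  have hlower : ∀ ψ, ∑ i, μ i * populations U ψ i ≤ energy K ψ := fun ψ => by
    simp only [hμ]
    exact sum_mul_populations_le_energy hV hK hα0 (fun j => hβanti (hlast j)) ψ
  -- A state of maximal entropy satisfies every constraint with `t ≤ log N`, so no feasible set is
  -- empty; it is also the minimizer at `s = log N`.
  obtain ⟨ψ₁, hψ₁, hE₁⟩ := exists_mem_entangledStates_energy_eq_sum_rev hU hV hK
  have hJ : ∀ t ≤ Real.log N, IsLeast (energy K '' entangledStates N t) (Jmin K t) :=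
    fun t ht => isLeast_Jmin K ⟨ψ₁, entangledStates_anti ht hψ₁⟩
  have hσ : μ (Fin.rev 0) = sigmaMin K := by
    -- The product of eigenvectors for the two smallest eigenvalues attains the lowest level.
    obtain ⟨ψ, hψ, hE⟩ := exists_mem_entangledStates_energy_eq_mul hU hV hK
      (Fin.rev 0) (Fin.rev 0)
    refine (IsLeast.csInf_eq (s := energy K '' entangledStates N 0)
      ⟨⟨ψ, hψ, hE.trans (hμ _).symm⟩, ?_⟩).symm
    rintro _ ⟨φ, hφ, rfl⟩
    exact (le_sum_mul_of_mem_stdSimplex hμmin (populations_mem_stdSimplex hU hφ.1)).trans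
      (hlower φ)
  refine ⟨hJ s hs, isLeast_relaxedJmin μ hs, hσ, ?_, fun hsd => ?_, fun hsd => ?_, ?_⟩
  · obtain ⟨ψ, hψ, hE⟩ := (hJ s hs).1
    rw [← hE]
    refine ((isLeast_relaxedJmin μ hs).2 (Set.mem_image_of_mem _ ?_)).trans (hlower ψ)
    exact ⟨populations_mem_stdSimplex hU hψ.1,
      hψ.2.trans (entanglementEntropy_le_sum_populations hU ψ)⟩
  · rw [← hσ]
    exact relaxedJmin_eq_of_le_log_card hμmin (hdmin ▸ hsd)
  · rw [hdmin] at hsd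
    obtain ⟨i, hi⟩ := exists_level_ne (hsd.trans_le hs)
    obtain ⟨γ, hγ, he⟩ := exists_gibbs_entropy_eq hμmin hsd hs
    have hval := relaxedJmin_eq_gibbsAverage hγ he
    refine ⟨γ, hγ, fun hlt => hγ.lt_of_ne ?_, he, fun γ' hγ' he' =>
      gibbs_entropy_injOn ⟨i, _, hi⟩ hγ' hγ (he'.trans he.symm), hval, ?_⟩
    -- At `γ = 0` the entropy equation would give `s = log N`.
    · rintro rfl
      rw [zero_mul, add_zero, partitionFn_zero] at he
      exact hlt.ne he.symm
    · rw [hval, ← hσ]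
      exact lt_gibbsAverage hμmin ⟨i, hi⟩ γ
  · rintro rfl
    refine ⟨IsLeast.csInf_eq (s := energy K '' entangledStates N (Real.log N))
      ⟨⟨ψ₁, hψ₁, hE₁⟩, ?_⟩, relaxedJmin_log μ, fun t ht => ?_⟩
    · rintro _ ⟨φ, hφ, rfl⟩
      exact sum_rev_le_energy hU hV hK hαanti hβanti hφ
    · obtain ⟨ψ, hψ, hE⟩ := (hJ _ le_rfl).1
      rw [← hE]
      exact (hJ t ht).2 (Set.mem_image_of_mem _ (entangledStates_anti ht hψ))
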